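/- There is an absolute constant $c>0$ such that the following holds. Let $F$ be a finite field with $q=|F|$ elements and characteristic $p$, let $d\ge 0$ be an integer with $q-q/p-1\ge d$, let $m\ge 0$ be an integer, and let $f:F^m\to F$ be a function. Let $\{P_{x,h}\}_{x,h\in F^m}$ be any family of univariate polynomials over $F$ of degree at most $d$, and let $\delta$ be a real number with $\delta\le \frac{1}{c(d+1)^2}$ and $$\Pr_{x,h,t}\left[P_{x,h}(t)\neq f(x+t\cdot h)\right]\le\delta,$$ where $x,h\in F^m$ and $t\in F$ are chosen uniformly and independently. Then there is a polynomial $g\in F[X_1,\dots,X_m]$ of total degree at most $d$ such that $$d(f,g):=\Pr_{x\in F^m}\left[f(x)\neq g(x)\right]\le 2\delta .$$ In particular, with the same constant $c$, this conclusion holds whenever $F$ is a field of prime order $q\ge d+2$. -/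

import Mathlib

open Polynomial

/-- Probability of the event `E` at a uniformly random point of a finite type. -/
noncomputable def uniformProb {α : Type*} [Fintype α] (E : α → Prop) : ℝ :=
  open Classical in
  ((Finset.univ.filter E).card : ℝ) / (Fintype.card α : ℝ)

/-- Relative Hamming distance of two functions on a finite domain:
`d(f, g) = Pr_x [f x ≠ g x]`. -/
noncomputable def relDist {α β : Type*} [Fintype α] (f g : α → β) : ℝ :=
  uniformProb fun x => f x ≠ g x

/-- The failure probability `Pr_{x,h,t} [P_{x,h}(t) ≠ f (x + t h)]` of the lines test, where
`x, h ∈ F^m` and `t ∈ F` are uniform and independent. -/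
noncomputable def linesTestError {F : Type*} [Field F] [Fintype F] {m : ℕ}
    (f : (Fin m → F) → F) (P : (Fin m → F) → (Fin m → F) → F[X]) : ℝ :=
  uniformProb fun w : (Fin m → F) × (Fin m → F) × F =>
    (P w.1 w.2.1).eval w.2.2 ≠ f (w.1 + w.2.2 • w.2.1)

/-- The lines test for degree `d` over `F`, with constant `c`, is sound: for every number of
variables `m`, every `f : F^m → F`, every family of univariate polynomials `P_{x,h}` of degree at
most `d` and every `δ ≤ 1 / (c (d+1)^2)`, if the test errs with probability at most `δ`, then `f`
is within distance `2δ` of a polynomial of total degree at most `d`. -/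
def LinesTestSound (c : ℝ) (F : Type*) [Field F] [Fintype F] (d : ℕ) : Prop :=
  ∀ (m : ℕ) (f : (Fin m → F) → F) (P : (Fin m → F) → (Fin m → F) → F[X]) (δ : ℝ),
    (∀ x h, (P x h).natDegree ≤ d) →
    δ ≤ 1 / (c * ((d : ℝ) + 1) ^ 2) →
    linesTestError f P ≤ δ →
    ∃ g : MvPolynomial (Fin m) F,
      g.totalDegree ≤ d ∧ relDist f (fun x => MvPolynomial.eval x g) ≤ 2 * δ

/-!
The function `f` is corrected by local extrapolation. Fix a set `T` of `d + 1` nonzero scalars; the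
values of `f` at the points `x + t h`, `t ∈ T`, extrapolate to a value at `x` (`extrapolate`), and
`g x` is the value obtained for most directions `h`. Reading each line from a random starting point
makes the error of the test the same `δ` at every fixed position of a random line
(`RandomLinePolys`).

The heart of the matter is that `g x` is well defined with room to spare: the minority directions
at *every* point `x` are a fraction `O((d + 1) δ)` of all directions, and not merely
`O((d + 1)² δ)`. In a random plane `x + u h₁ + v h₂`, extrapolating the columns `u = i`, `i ∈ T`,
to `u = 0` along the line `v = c` and along the line `v = b u + c` gives two values at the same
point, whose difference is a polynomial `S(b, c)` of total degree at most `d`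
(`RandomLinePolys.defect`). Each point of the grid `T × T` is a zero of `S` except with probability
`O((d + 1) δ)`, so with probability `1 - O((d + 1)² δ)` there are too few nonzeros for `S` to be
nonzero (Schwartz–Zippel). Then `S(b, 0) = 0` says that all directions `h₁ + b h₂` extrapolate to
the same value at `x` (`RandomLinePolys.uniformProb_extrapolate_not_constant_le`). A plane provides
`d + 2` pairwise independent directions, so a second moment bound gains the factor `d + 2`
(`RandomLinePolys.exists_uniformProb_extrapolate_ne_le`).

For a given line `x + s h`, the ruled surface `x + s h + t (h₁ + s h₂)` has random lines as its
rows `t = const`, and they extrapolate to a polynomial of degree at most `d` on the row `t = 0`. By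
the gained factor, a union bound over any `d + 2` columns shows that `g` agrees there with such a
polynomial; so `g` has degree at most `d` on every line
(`RandomLinePolys.exists_close_degree_le_on_lines`).

If `q - q / p - 1 ≥ d`, then degree at most `d` on every line implies total degree at most `d`
(`exists_totalDegree_le_of_degree_le_on_lines`): a monomial of exponent `I` of larger degree would,
on a line, produce `t ^ e` for every degree `e` of an exponent vector dominated by `I` digit by
digit in base `p`, and consecutive such degrees can be chosen at most `q / p` apart, so one of them
falls between `d + 1` and `q - 1`.

The correction gives only `ε = O((d + 1) δ)` for the distance `ε` of `f` from `g`. Counting the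
disagreements of `f` with `g` on a random line, whose points are pairwise independent, improves this
to `ε - (d + 1) ε² ≤ δ` (`relDist_sub_le_uniformProb`), hence `ε ≤ 2 δ`.
-/

/-! ### Uniform probabilities -/

section UniformProb

theorem uniformProb_eq_expect {α : Type*} [Fintype α] (E : α → Prop) [DecidablePred E] :
    uniformProb E = Finset.univ.expect fun a => if E a then (1 : ℝ) else 0 := by
  rw [uniformProb, Fintype.expect_eq_sum_div_card, Finset.sum_boole]
  congr!

variable {α β : Type*} [Fintype α] [Fintype β]

theorem uniformProb_nonneg (E : α → Prop) : 0 ≤ uniformProb E := by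
  unfold uniformProb; positivity

theorem uniformProb_mono {E E' : α → Prop} (h : ∀ a, E a → E' a) :
    uniformProb E ≤ uniformProb E' := by
  classical
  rw [uniformProb_eq_expect, uniformProb_eq_expect]
  refine Finset.expect_le_expect fun a _ => ?_
  by_cases h1 : E a
  · simp [h1, h a h1]
  · by_cases h2 : E' a <;> simp [h1, h2]

theorem uniformProb_comp_equiv (e : α ≃ β) (E : β → Prop) :
    uniformProb (fun a => E (e a)) = uniformProb E := by
  classical
  rw [uniformProb_eq_expect, uniformProb_eq_expect]
  exact Fintype.expect_equiv e _ _ fun _ => rfl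

theorem uniformProb_comp_bijective {e : α → β} (he : Function.Bijective e) (E : β → Prop) :
    uniformProb (fun a => E (e a)) = uniformProb E :=
  uniformProb_comp_equiv (Equiv.ofBijective e he) E

theorem uniformProb_or_le (E E' : α → Prop) :
    uniformProb (fun a => E a ∨ E' a) ≤ uniformProb E + uniformProb E' := by
  classical
  simp only [uniformProb_eq_expect]
  rw [← Finset.expect_add_distrib]
  refine Finset.expect_le_expect fun a _ => ?_
  by_cases h1 : E a <;> by_cases h2 : E' a <;> simp [h1, h2]

theorem uniformProb_exists_mem_le {κ : Type*} (s : Finset κ) (E : κ → α → Prop) :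
    uniformProb (fun a => ∃ i ∈ s, E i a) ≤ ∑ i ∈ s, uniformProb (E i) := by
  classical
  induction s using Finset.induction_on with
  | empty => simp [uniformProb]
  | insert i s hi ih =>
    rw [Finset.sum_insert hi]
    refine le_trans (uniformProb_mono fun a => ?_)
      ((uniformProb_or_le (E i) fun a => ∃ j ∈ s, E j a).trans (by gcongr))
    simp

theorem uniformProb_exists_mem_le_card_mul {κ : Type*} (s : Finset κ) (E : κ → α → Prop) {r : ℝ}
    (h : ∀ i ∈ s, uniformProb (E i) ≤ r) :
    uniformProb (fun a => ∃ i ∈ s, E i a) ≤ s.card * r := by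
  refine (uniformProb_exists_mem_le s E).trans ((Finset.sum_le_sum h).trans ?_)
  simp

theorem exists_not_of_uniformProb_lt_one [Nonempty α] {E : α → Prop} (h : uniformProb E < 1) :
    ∃ a, ¬ E a := by
  classical
  by_contra! hE
  have : (Fintype.card α : ℝ) ≠ 0 := by positivity
  simp [uniformProb, hE, this] at h

theorem uniformProb_not [Nonempty α] (E : α → Prop) :
    uniformProb (fun a => ¬ E a) = 1 - uniformProb E := by
  classical
  have h : (1 : ℝ) = Finset.univ.expect fun _ : α => (1 : ℝ) := (Fintype.expect_const _).symm
  simp only [uniformProb_eq_expect]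
  rw [h, ← Finset.expect_sub_distrib]
  refine Finset.expect_congr rfl fun a _ => ?_
  by_cases h1 : E a <;> simp [h1]

theorem uniformProb_fst [Nonempty β] (E : α → Prop) :
    uniformProb (fun w : α × β => E w.1) = uniformProb E := by
  classical
  simp only [uniformProb_eq_expect]
  rw [← Finset.univ_product_univ, Finset.expect_product]
  exact Finset.expect_congr rfl fun a _ => Fintype.expect_const (if E a then (1 : ℝ) else 0)

theorem uniformProb_snd [Nonempty α] (E : β → Prop) :
    uniformProb (fun w : α × β => E w.2) = uniformProb E := by
  rw [← uniformProb_fst (β := α) E]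
  exact uniformProb_comp_equiv (Equiv.prodComm α β) fun w => E w.1

theorem uniformProb_prod (E : α × β → Prop) :
    uniformProb E = Finset.univ.expect fun a => uniformProb fun b => E (a, b) := by
  classical
  simp only [uniformProb_eq_expect]
  rw [← Finset.univ_product_univ, Finset.expect_product]

theorem uniformProb_fst_and_snd (E : α → Prop) (E' : β → Prop) :
    uniformProb (fun w : α × β => E w.1 ∧ E' w.2) = uniformProb E * uniformProb E' := by
  classical
  rw [uniformProb_prod]
  simp only [uniformProb_eq_expect]
  rw [Finset.expect_mul]
  refine Finset.expect_congr rfl fun a _ => ?_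
  rw [Finset.mul_expect]
  refine Finset.expect_congr rfl fun b _ => ?_
  by_cases h1 : E a <;> by_cases h2 : E' b <;> simp [h1, h2]

/-- **Markov's inequality** for the number of events of a finite family that occur. -/
theorem mul_uniformProb_le_card_filter_le {κ : Type*} (s : Finset κ) (E : κ → α → Prop) (n : ℕ) :
    n * uniformProb (fun a => open Classical in n ≤ (s.filter fun i => E i a).card) ≤
      ∑ i ∈ s, uniformProb (E i) := by
  classical
  simp only [uniformProb_eq_expect]
  rw [Finset.mul_expect, ← Finset.expect_sum_comm]
  refine Finset.expect_le_expect fun a _ => ?_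
  rw [Finset.sum_boole]
  split_ifs with h
  · simpa using h
  · simp

/-- If the events `E i` are pairwise independent of the same probability `τ`, then at least one of
`N` of them occurs with probability at least `N τ / (1 + N τ)`. -/
theorem mul_le_one_add_mul_uniformProb_exists {κ : Type*} (s : Finset κ) (E : κ → α → Prop) (τ : ℝ)
    (h1 : ∀ i ∈ s, uniformProb (E i) = τ)
    (h2 : ∀ i ∈ s, ∀ j ∈ s, i ≠ j → uniformProb (fun a => E i a ∧ E j a) = τ * τ) (hτ : 0 ≤ τ) :
    s.card * τ ≤ (1 + s.card * τ) * uniformProb (fun a => ∃ i ∈ s, E i a) := by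
  classical
  set X : α → ℝ := fun a => ∑ i ∈ s, if E i a then (1 : ℝ) else 0 with hX
  have hEX : Finset.univ.expect X = s.card * τ := by
    rw [hX, Finset.expect_sum_comm, Finset.sum_congr rfl fun i hi =>
      (uniformProb_eq_expect (E i)).symm.trans (h1 i hi)]
    simp
  have hEX2 : Finset.univ.expect (fun a => X a ^ 2) ≤ s.card * τ + (s.card * τ) ^ 2 := by
    have : ∀ a, X a ^ 2 = ∑ i ∈ s, ∑ j ∈ s, if E i a ∧ E j a then (1 : ℝ) else 0 := by
      intro a
      rw [sq, hX, Finset.sum_mul_sum]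
      refine Finset.sum_congr rfl fun i _ => Finset.sum_congr rfl fun j _ => ?_
      by_cases h1 : E i a <;> by_cases h2 : E j a <;> simp [h1, h2]
    simp_rw [this]
    rw [Finset.expect_sum_comm]
    calc ∑ i ∈ s, Finset.univ.expect (fun a => ∑ j ∈ s, if E i a ∧ E j a then (1 : ℝ) else 0)
        ≤ ∑ i ∈ s, ∑ j ∈ s, ((if i = j then τ else 0) + τ * τ) := by
          refine Finset.sum_le_sum fun i hi => ?_
          rw [Finset.expect_sum_comm]
          refine Finset.sum_le_sum fun j hj => ?_
          rw [← uniformProb_eq_expect]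
          split_ifs with h
          · subst h
            simp only [and_self, h1 i hi]
            nlinarith
          · rw [h2 i hi j hj h, zero_add]
      _ = s.card * τ + (s.card * τ) ^ 2 := by
          simp only [Finset.sum_add_distrib, Finset.sum_ite_eq, Finset.sum_ite_mem,
            Finset.inter_self, Finset.sum_const, nsmul_eq_mul]
          ring
  -- Pointwise `1_{X ≥ 1} ≥ 2 l X - l² X²` for every `l`; the choice `l = 1 / (1 + E X)` is optimal.
  set m : ℝ := s.card * τ with hm
  have hm0 : 0 ≤ m := by positivity
  set l : ℝ := 1 / (1 + m) with hl
  have key : 2 * l * m - l ^ 2 * (m + m ^ 2) ≤ uniformProb (fun a => ∃ i ∈ s, E i a) := by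
    calc 2 * l * m - l ^ 2 * (m + m ^ 2)
        ≤ 2 * l * Finset.univ.expect X - l ^ 2 * Finset.univ.expect (fun a => X a ^ 2) := by
          rw [hEX]; gcongr
      _ = Finset.univ.expect fun a => (2 * l * X a - l ^ 2 * X a ^ 2) := by
          rw [Finset.expect_sub_distrib, Finset.mul_expect, Finset.mul_expect]
      _ ≤ _ := by
          rw [uniformProb_eq_expect]
          refine Finset.expect_le_expect fun a _ => ?_
          split_ifs with h
          · nlinarith [sq_nonneg (1 - l * X a)]
          · push Not at h
            have : X a = 0 := Finset.sum_eq_zero fun i hi => by simp [h i hi]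
            simp [this]
  have h1m : (1 + m) * l = 1 := by rw [hl]; field_simp
  calc m = (1 + m) * (2 * l * m - l ^ 2 * (m + m ^ 2)) := by
        linear_combination (-(2 * m) + m * ((1 + m) * l + 1)) * h1m
    _ ≤ _ := by gcongr

/-- If two independent samples of a random variable coincide with probability at least `1 - μ`,
then the variable takes some single value with probability at least `1 - μ`. -/
theorem exists_uniformProb_ne_le [Nonempty α] {γ : Type*} (φ : α → γ) {μ : ℝ}
    (h : uniformProb (fun w : α × α => φ w.1 ≠ φ w.2) ≤ μ) :
    ∃ v, uniformProb (fun a => φ a ≠ v) ≤ μ := by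
  rw [uniformProb_prod] at h
  obtain ⟨a, -, ha⟩ := Finset.exists_le_of_expect_le (s := Finset.univ)
    (f := fun a => uniformProb fun b => φ a ≠ φ b) Finset.univ_nonempty h
  exact ⟨φ a, le_trans (uniformProb_mono fun b hb => hb.symm) ha⟩

end UniformProb

/-! ### Interpolation at `0` and bivariate vanishing -/

section Interpolation

variable {F : Type*} [Field F]

open Classical in
/-- The weight of the node `t` in Lagrange extrapolation from the nodes `T` to the point `0`. -/
noncomputable def zeroWeight (T : Finset F) (t : F) : F :=
  (Lagrange.basis T id t).eval 0

theorem eval_zero_eq_sum_zeroWeight {T : Finset F} {P : F[X]} (h : P.natDegree < T.card) :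
    P.eval 0 = ∑ t ∈ T, zeroWeight T t * P.eval t := by
  classical
  have hd : P.degree < T.card :=
    lt_of_le_of_lt P.degree_le_natDegree (by exact_mod_cast h)
  conv_lhs => rw [Lagrange.eq_interpolate (v := id) (s := T) Function.injective_id.injOn hd]
  rw [Lagrange.interpolate_apply, eval_finsetSum]
  refine Finset.sum_congr rfl fun t _ => ?_
  rw [eval_mul, eval_C, mul_comm, id, zeroWeight, mul_comm]

theorem totalDegree_aeval_le {σ : Type*} (P : F[X]) (L : MvPolynomial σ F)
    (hL : L.totalDegree ≤ 1) : (Polynomial.aeval L P).totalDegree ≤ P.natDegree := by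
  rw [Polynomial.aeval_eq_sum_range]
  refine MvPolynomial.totalDegree_finsetSum_le fun i hi => ?_
  refine (MvPolynomial.totalDegree_smul_le _ _).trans ((MvPolynomial.totalDegree_pow _ _).trans ?_)
  have := Finset.mem_range.1 hi
  calc i * L.totalDegree ≤ i * 1 := by gcongr
    _ ≤ P.natDegree := by omega

/-- A polynomial of total degree at most `d` in two variables which is nonzero at no more than `d`
points of a square grid of side `d + 1` vanishes identically. -/
theorem MvPolynomial.eq_zero_of_card_filter_eval_ne_zero_le {d : ℕ} {T : Finset F}
    (hT : T.card = d + 1) {S : MvPolynomial (Fin 2) F} (hS : S.totalDegree ≤ d)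
    (h : (open Classical in
      ((Fintype.piFinset fun _ : Fin 2 => T).filter fun w => MvPolynomial.eval w S ≠ 0).card) ≤ d) :
    S = 0 := by
  classical
  by_contra hne
  have hsz := MvPolynomial.schwartz_zippel_totalDegree hne T
  have hsplit := Finset.card_filter_add_card_filter_not
    (s := Fintype.piFinset fun _ : Fin 2 => T) (fun w => MvPolynomial.eval w S = 0)
  rw [Fintype.card_piFinset_const, hT] at hsplit
  rw [hT] at hsz
  set Z := ((Fintype.piFinset fun _ : Fin 2 => T).filter fun w => MvPolynomial.eval w S = 0).card
    with hZ
  have hpos : (0 : ℚ≥0) < ((d + 1 : ℕ) : ℚ≥0) := by exact_mod_cast Nat.succ_pos d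
  rw [div_le_div_iff₀ (by positivity) hpos] at hsz
  have hsz' : Z * (d + 1) ≤ S.totalDegree * (d + 1) ^ 2 := by exact_mod_cast hsz
  have : Z * (d + 1) ≤ d * (d + 1) ^ 2 := hsz'.trans (by gcongr)
  have : Z ≤ d * (d + 1) := by nlinarith
  have h' : ((Fintype.piFinset fun _ : Fin 2 => T).filter
      fun w => ¬ MvPolynomial.eval w S = 0).card ≤ d := by convert h
  nlinarith

/-- Let `S(b, c) = ∑ κᵢ (Qᵢ(c) - Qᵢ(b i + c))` with univariate `Qᵢ` of degree at most `d`. If `S`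
is nonzero at no more than `d` points of a square grid of side `d + 1`, it vanishes everywhere. -/
theorem sum_mul_eval_sub_eval_eq_zero {d : ℕ} {T : Finset F} (hT : T.card = d + 1)
    (κ : F → F) {Q : F → F[X]} (hQ : ∀ i, (Q i).natDegree ≤ d)
    (h : (open Classical in ((Fintype.piFinset fun _ : Fin 2 => T).filter fun w =>
      ∑ i ∈ T, κ i * ((Q i).eval (w 1) - (Q i).eval (w 0 * i + w 1)) ≠ 0).card) ≤ d) (b c : F) :
    ∑ i ∈ T, κ i * ((Q i).eval c - (Q i).eval (b * i + c)) = 0 := by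
  classical
  set S : MvPolynomial (Fin 2) F := ∑ i ∈ T, MvPolynomial.C (κ i) *
    (aeval (MvPolynomial.X 1 : MvPolynomial (Fin 2) F) (Q i) -
      aeval (MvPolynomial.C i * MvPolynomial.X 0 + MvPolynomial.X 1 : MvPolynomial (Fin 2) F)
        (Q i)) with hSdef
  have heval : ∀ w : Fin 2 → F, MvPolynomial.eval w S =
      ∑ i ∈ T, κ i * ((Q i).eval (w 1) - (Q i).eval (w 0 * i + w 1)) := by
    intro w
    rw [hSdef, map_sum]
    refine Finset.sum_congr rfl fun i _ => ?_
    have hae : ∀ L : MvPolynomial (Fin 2) F, MvPolynomial.eval w (aeval L (Q i)) =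
        (Q i).eval (MvPolynomial.eval w L) := by
      intro L
      rw [← MvPolynomial.coe_aeval_eq_eval, RingHom.coe_coe, ← Polynomial.aeval_algHom_apply]
      simp [Polynomial.aeval_def]
    simp only [map_mul, map_sub, map_add, hae, MvPolynomial.eval_C, MvPolynomial.eval_X]
    rw [mul_comm i]
  have hdeg : S.totalDegree ≤ d := by
    refine MvPolynomial.totalDegree_finsetSum_le fun i _ => ?_
    refine (MvPolynomial.totalDegree_mul _ _).trans ?_
    rw [MvPolynomial.totalDegree_C, zero_add]
    refine (MvPolynomial.totalDegree_sub _ _).trans (max_le ?_ ?_)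
    · exact (totalDegree_aeval_le _ _ (by simp)).trans (hQ i)
    · refine (totalDegree_aeval_le _ _ ?_).trans (hQ i)
      refine (MvPolynomial.totalDegree_add _ _).trans (max_le ?_ (by simp))
      refine (MvPolynomial.totalDegree_mul _ _).trans ?_
      simp
  have hS : S = 0 := by
    refine MvPolynomial.eq_zero_of_card_filter_eval_ne_zero_le hT hdeg ?_
    simp_rw [heval]
    exact h
  have := heval ![b, c]
  rw [hS, map_zero] at this
  simpa using this.symm

end Interpolation

/-! ### Random pairs of vectors -/

section Pairs

variable {F V : Type*} [Field F] [AddCommGroup V] [Module F V] [Fintype V]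

/-- An invertible affine substitution maps a uniform pair of vectors to a uniform pair. -/
theorem uniformProb_affine_pair (E : V × V → Prop) (φ : V × V → V × V) (y z : V) (a b c d : F)
    (hφ : ∀ w, φ w = (y + a • w.1 + b • w.2, z + c • w.1 + d • w.2)) (hdet : a * d - b * c ≠ 0) :
    uniformProb (fun w => E (φ w)) = uniformProb E := by
  refine uniformProb_comp_bijective (Finite.injective_iff_bijective.1 ?_) E
  rintro ⟨u, v⟩ ⟨u', v'⟩ h
  simp only [hφ, Prod.mk.injEq] at h
  obtain ⟨h1, h2⟩ := h
  have hu : (a * d - b * c) • u = (a * d - b * c) • u' := by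
    linear_combination (norm := module) d • h1 - b • h2
  have hv : (a * d - b * c) • v = (a * d - b * c) • v' := by
    linear_combination (norm := module) a • h2 - c • h1
  rw [smul_right_injective V hdet hu, smul_right_injective V hdet hv]

/-- `y + a u + b v` is uniform for a uniform pair `(u, v)` unless `a = b = 0`. -/
theorem uniformProb_affine (E : V → Prop) (φ : V × V → V) (y : V) (a b : F)
    (hφ : ∀ w, φ w = y + a • w.1 + b • w.2) (hab : a ≠ 0 ∨ b ≠ 0) :
    uniformProb (fun w => E (φ w)) = uniformProb E := by
  rw [← uniformProb_fst (β := V) E]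
  rcases hab with h | h
  · exact uniformProb_affine_pair (fun w => E w.1) (fun w => (φ w, w.2)) y 0 a b 0 1
      (fun w => by simp [hφ]) (by simpa using h)
  · exact uniformProb_affine_pair (fun w => E w.1) (fun w => (φ w, w.1)) y 0 a b 1 0
      (fun w => by simp [hφ]) (by simpa using h)

end Pairs

/-! ### Extrapolation along random lines -/

section Extrapolation

/-- A family of univariate polynomials of degree at most `d`, one for each line
`t ↦ x + t h` and each value of a seed in `ι`, which predicts each *fixed* position `s` of a random
line with error probability at most `δ`. -/
structure RandomLinePolys (ι : Type*) [Fintype ι] {F V : Type*} [Field F] [AddCommGroup V]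
    [Module F V] [Fintype V] (f : V → F) (d : ℕ) (δ : ℝ) where
  /-- The polynomial of the line `t ↦ x + t h` for a given seed. -/
  poly : ι → V → V → F[X]
  natDegree_le : ∀ i x h, (poly i x h).natDegree ≤ d
  error_le : ∀ s : F, uniformProb (fun w : ι × V × V =>
    (poly w.1 w.2.1 w.2.2).eval s ≠ f (w.2.1 + s • w.2.2)) ≤ δ

variable {ι F V : Type*} [Fintype ι] [Field F] [AddCommGroup V] [Module F V] [Fintype V]

/-- The value at `x` extrapolated from the values of `f` at the points `x + t h`, `t ∈ T`. -/
noncomputable def extrapolate (f : V → F) (T : Finset F) (x h : V) : F :=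
  ∑ t ∈ T, zeroWeight T t * f (x + t • h)

namespace RandomLinePolys

variable {f : V → F} {d : ℕ} {δ : ℝ} (R : RandomLinePolys ι f d δ)

theorem error_affine_le (s : F) (φ : V × V → V × V) (y z : V) (a b c e : F)
    (hφ : ∀ w, φ w = (y + a • w.1 + b • w.2, z + c • w.1 + e • w.2)) (hdet : a * e - b * c ≠ 0) :
    uniformProb (fun w : ι × V × V => (R.poly w.1 (φ w.2).1 (φ w.2).2).eval s ≠
      f ((φ w.2).1 + s • (φ w.2).2)) ≤ δ := by
  refine le_trans (le_of_eq ?_) (R.error_le s)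
  rw [uniformProb_prod, uniformProb_prod]
  refine Finset.expect_congr rfl fun i _ => ?_
  exact uniformProb_affine_pair (fun w => (R.poly i w.1 w.2).eval s ≠ f (w.1 + s • w.2))
    φ y z a b c e hφ hdet

theorem eval_zero_eq_extrapolate {T : Finset F} (hT : T.card = d + 1) {i : ι} {x h : V}
    (hx : ∀ t ∈ T, (R.poly i x h).eval t = f (x + t • h)) :
    (R.poly i x h).eval 0 = extrapolate f T x h := by
  rw [eval_zero_eq_sum_zeroWeight (T := T) (by have := R.natDegree_le i x h; omega), extrapolate]
  exact Finset.sum_congr rfl fun t ht => by rw [hx t ht]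

/-- The error of `R` on the line `u ↦ y + c h₂ + u (h₁ + b h₂)`. -/
theorem error_oblique_le (y : V) (s b : F) {c : F} (hc : c ≠ 0) :
    uniformProb (fun w : ι × V × V => (R.poly w.1 (y + c • w.2.2) (w.2.1 + b • w.2.2)).eval s ≠
      f (y + c • w.2.2 + s • (w.2.1 + b • w.2.2))) ≤ δ :=
  R.error_affine_le s (fun w => (y + c • w.2, w.1 + b • w.2)) y 0 0 c 1 b
    (fun w => by simp) (by simpa using hc)

/-- The error of `R` on the line `v ↦ y + i h₁ + v h₂`. -/
theorem error_column_le (y : V) (s : F) {i : F} (hi : i ≠ 0) :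
    uniformProb (fun w : ι × V × V => (R.poly w.1 (y + i • w.2.1) w.2.2).eval s ≠
      f (y + i • w.2.1 + s • w.2.2)) ≤ δ :=
  R.error_affine_le s (fun w => (y + i • w.1, w.2)) y 0 i 0 0 1
    (fun w => by simp) (by simpa using hi)

/-- The defect `S(b, c)` of the columns `u = i`, `i ∈ T`, of the plane `y + u h₁ + v h₂`: it
compares the extrapolations of the columns to `u = 0` along the line `v = c` and along the line
`v = b u + c`, which meet there. As a polynomial in `(b, c)` it has total degree at most `d`. -/
noncomputable def defect (T : Finset F) (y : V) (w : ι × V × V) (b c : F) : F :=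
  ∑ i ∈ T, zeroWeight T i * ((R.poly w.1 (y + i • w.2.1) w.2.2).eval c -
    (R.poly w.1 (y + i • w.2.1) w.2.2).eval (b * i + c))

theorem uniformProb_defect_ne_zero_le (hδ : 0 ≤ δ) {T : Finset F} (hT : T.card = d + 1)
    (hT0 : (0 : F) ∉ T) (y : V) (b : F) {c : F} (hc : c ≠ 0) :
    uniformProb (fun w : ι × V × V => R.defect T y w b c ≠ 0) ≤ 6 * (d + 1) * δ := by
  classical
  have hne : ∀ i ∈ T, i ≠ 0 := fun i hi h => hT0 (h ▸ hi)
  -- On the line `v = b' u + c`, `R` agrees with `f` at `u = 0` and with the columns at `u ∈ T`.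
  set obl : F → ι × V × V → Prop := fun b' w => ∃ s ∈ insert 0 T,
    (R.poly w.1 (y + c • w.2.2) (w.2.1 + b' • w.2.2)).eval s ≠
      f (y + c • w.2.2 + s • (w.2.1 + b' • w.2.2)) with hobl
  set col : F → ι × V × V → Prop := fun b' w => ∃ i ∈ T,
    (R.poly w.1 (y + i • w.2.1) w.2.2).eval (b' * i + c) ≠
      f (y + i • w.2.1 + (b' * i + c) • w.2.2) with hcol
  have hoblP : ∀ b', uniformProb (obl b') ≤ (d + 2) * δ := by
    intro b'
    refine (uniformProb_exists_mem_le_card_mul _ _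
      fun s _ => R.error_oblique_le y s b' hc).trans (le_of_eq ?_)
    rw [Finset.card_insert_of_notMem hT0, hT]
    push_cast; ring
  have hcolP : ∀ b', uniformProb (col b') ≤ (d + 1) * δ := by
    intro b'
    refine (uniformProb_exists_mem_le_card_mul _ _
      fun i hi => R.error_column_le y (b' * i + c) (hne i hi)).trans (le_of_eq ?_)
    rw [hT]; push_cast; ring
  have hgood : ∀ b' w, ¬ obl b' w → ¬ col b' w →
      ∑ i ∈ T, zeroWeight T i * (R.poly w.1 (y + i • w.2.1) w.2.2).eval (b' * i + c) =
        f (y + c • w.2.2) := by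
    intro b' w h1 h2
    simp only [hobl, hcol] at h1 h2
    push Not at h1 h2
    have h0 := h1 0 (Finset.mem_insert_self _ _)
    rw [R.eval_zero_eq_extrapolate hT fun t ht => h1 t (Finset.mem_insert_of_mem ht),
      zero_smul, add_zero] at h0
    rw [← h0, extrapolate]
    refine Finset.sum_congr rfl fun i hi => ?_
    rw [h2 i hi]
    congr 2
    module
  refine (uniformProb_mono (E' := fun w => (obl b w ∨ col b w) ∨ (obl 0 w ∨ col 0 w)) ?_).trans ?_
  · intro w hw
    by_contra! h
    refine hw ?_
    have h1 := hgood b w h.1.1 h.1.2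
    have h2 := hgood 0 w h.2.1 h.2.2
    simp only [zero_mul, zero_add] at h2
    simp only [defect, mul_sub, Finset.sum_sub_distrib]
    rw [h1, h2, sub_self]
  · refine (uniformProb_or_le _ _).trans ((add_le_add (uniformProb_or_le _ _)
      (uniformProb_or_le _ _)).trans ?_)
    have := hoblP b
    have := hoblP 0
    have := hcolP b
    have := hcolP 0
    have : (0 : ℝ) ≤ d * δ := by positivity
    nlinarith

/-- In a random plane through `y`, the extrapolations to `y` along `d + 2` fixed directions all
agree except with probability `O((d + 1)² δ)`. -/
theorem uniformProb_extrapolate_not_constant_le [Nonempty ι]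
    (R : RandomLinePolys ι f d δ) (hδ : 0 ≤ δ) {T : Finset F} (hT : T.card = d + 1)
    (hT0 : (0 : F) ∉ T) (y : V) :
    uniformProb (fun w : V × V => ∃ b ∈ T,
      extrapolate f T y (w.1 + b • w.2) ≠ extrapolate f T y w.1) ≤ 8 * (d + 1) ^ 2 * δ := by
  classical
  have hne : ∀ i ∈ T, i ≠ 0 := fun i hi h => hT0 (h ▸ hi)
  rw [← uniformProb_snd (α := ι)]
  set G := Fintype.piFinset fun _ : Fin 2 => T with hG
  set many : ι × V × V → Prop := fun w =>
    d + 1 ≤ (G.filter fun p => R.defect T y w (p 0) (p 1) ≠ 0).card with hmany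
  set col : ι × V × V → Prop := fun w => ∃ p ∈ insert 0 T ×ˢ T,
    (R.poly w.1 (y + p.2 • w.2.1) w.2.2).eval (p.1 * p.2) ≠
      f (y + p.2 • w.2.1 + (p.1 * p.2) • w.2.2) with hcol
  have hmanyP : uniformProb many ≤ 6 * (d + 1) ^ 2 * δ := by
    have h1 := mul_uniformProb_le_card_filter_le G
      (fun p (w : ι × V × V) => R.defect T y w (p 0) (p 1) ≠ 0) (d + 1)
    have h2 : ∑ p ∈ G, uniformProb (fun w : ι × V × V => R.defect T y w (p 0) (p 1) ≠ 0) ≤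
        (d + 1 : ℝ) ^ 2 * (6 * (d + 1) * δ) := by
      refine (Finset.sum_le_card_nsmul G _ _ fun p hp =>
        R.uniformProb_defect_ne_zero_le hδ hT hT0 y (p 0)
          (hne _ (Fintype.mem_piFinset.1 hp 1))).trans (le_of_eq ?_)
      rw [hG, Fintype.card_piFinset_const, hT, nsmul_eq_mul]
      push_cast; ring
    have h3 : (d + 1 : ℝ) * uniformProb many ≤ (d + 1 : ℝ) * (6 * (d + 1) ^ 2 * δ) := by
      refine le_trans ?_ (h2.trans (le_of_eq (by ring)))
      refine le_trans (le_of_eq ?_) h1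
      push_cast
      congr!
    exact le_of_mul_le_mul_left h3 (by positivity)
  have hcolP : uniformProb col ≤ (d + 2) * (d + 1) * δ := by
    have hp : ∀ p ∈ insert 0 T ×ˢ T, uniformProb (fun w : ι × V × V =>
        (R.poly w.1 (y + p.2 • w.2.1) w.2.2).eval (p.1 * p.2) ≠
          f (y + p.2 • w.2.1 + (p.1 * p.2) • w.2.2)) ≤ δ := fun p hp =>
      R.error_column_le y (p.1 * p.2) (hne p.2 (Finset.mem_product.1 hp).2)
    refine (uniformProb_exists_mem_le_card_mul _ _ hp).trans (le_of_eq ?_)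
    rw [Finset.card_product, Finset.card_insert_of_notMem hT0, hT]
    push_cast; ring
  refine (uniformProb_mono (E' := fun w => many w ∨ col w) ?_).trans
    ((uniformProb_or_le _ _).trans ?_)
  · rintro w ⟨b, hb, hbw⟩
    by_contra! h
    obtain ⟨h1, h2⟩ := h
    simp only [hmany, hcol, not_le] at h1 h2
    push Not at h2
    have hS := sum_mul_eval_sub_eval_eq_zero hT (zeroWeight T)
      (Q := fun i => R.poly w.1 (y + i • w.2.1) w.2.2) (fun i => R.natDegree_le _ _ _)
      (by convert Nat.lt_succ_iff.1 h1; rfl)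
    have hval : ∀ b ∈ insert 0 T,
        ∑ i ∈ T, zeroWeight T i * (R.poly w.1 (y + i • w.2.1) w.2.2).eval (b * i) =
          extrapolate f T y (w.2.1 + b • w.2.2) := by
      intro b hb
      rw [extrapolate]
      refine Finset.sum_congr rfl fun i hi => ?_
      rw [h2 (b, i) (Finset.mem_product.2 ⟨hb, hi⟩)]
      congr 2
      module
    have hb0 := hval 0 (Finset.mem_insert_self _ _)
    have hb1 := hval b (Finset.mem_insert_of_mem hb)
    have hSb := hS b 0
    simp only [mul_sub, Finset.sum_sub_distrib, add_zero, sub_eq_zero] at hSb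
    simp only [zero_mul, zero_smul, add_zero] at hb0
    exact hbw (by rw [← hb1, ← hb0, hSb])
  · have : (0 : ℝ) ≤ d * δ := by positivity
    have : (0 : ℝ) ≤ d * (d * δ) := by positivity
    nlinarith

end RandomLinePolys

end Extrapolation

/-! ### The corrected function -/

section Correction

variable {ι F V : Type*} [Fintype ι] [Nonempty ι] [Field F] [AddCommGroup V] [Module F V]
  [Fintype V] {f : V → F} {d : ℕ} {δ : ℝ}

namespace RandomLinePolys

/-- Among the extrapolations of `f` to `y` there is a value taken in all but a fraction
`O((d + 1) δ)` of the directions. A random plane through `y` gives all of its directions the same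
extrapolation with probability `1 - O((d + 1)² δ)`; since its `d + 2` directions are pairwise
independent, directions with a minority value cannot be more frequent than that divided by
`d + 2`. -/
theorem exists_uniformProb_extrapolate_ne_le (R : RandomLinePolys ι f d δ) (hδ : 0 ≤ δ)
    (hsmall : (d + 1) ^ 2 * δ ≤ 1 / 1000) {T : Finset F} (hT : T.card = d + 1)
    (hT0 : (0 : F) ∉ T) (y : V) :
    ∃ v, (d + 2) * uniformProb (fun h => extrapolate f T y h ≠ v) ≤ 1 / 50 := by
  classical
  have hne : ∀ i ∈ T, i ≠ 0 := fun i hi h => hT0 (h ▸ hi)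
  set A := extrapolate f T y with hA
  have hplane : uniformProb (fun w : V × V => ∃ b ∈ T, A (w.1 + b • w.2) ≠ A w.1) ≤ 8 / 1000 :=
    (R.uniformProb_extrapolate_not_constant_le hδ hT hT0 y).trans (by linarith)
  obtain ⟨b₀, hb₀⟩ : T.Nonempty := Finset.card_pos.1 (by omega)
  obtain ⟨v, hv⟩ := exists_uniformProb_ne_le (φ := A) (μ := 8 / 1000) <| by
    rw [← uniformProb_affine_pair (fun w : V × V => A w.1 ≠ A w.2)
      (fun w => (w.1 + b₀ • w.2, w.1)) 0 0 1 b₀ 1 0 (fun w => by simp)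
      (by simpa using hne b₀ hb₀)]
    exact (uniformProb_mono fun w hw => ⟨b₀, hb₀, hw⟩).trans hplane
  refine ⟨v, ?_⟩
  set τ := uniformProb (fun h => A h ≠ v) with hτ
  have hdir : ∀ b : F, uniformProb (fun w : V × V => A (w.1 + b • w.2) ≠ v) = τ := fun b =>
    uniformProb_affine (fun h => A h ≠ v) (fun w => w.1 + b • w.2) 0 1 b (fun w => by simp)
      (by simp)
  have hsecond := mul_le_one_add_mul_uniformProb_exists (insert 0 T)
    (fun b (w : V × V) => A (w.1 + b • w.2) ≠ v) τ (fun b _ => hdir b)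
    (fun b _ b' _ hbb => by
      rw [hτ, ← uniformProb_fst_and_snd]
      exact uniformProb_affine_pair (fun w : V × V => A w.1 ≠ v ∧ A w.2 ≠ v)
        (fun w => (w.1 + b • w.2, w.1 + b' • w.2)) 0 0 1 b 1 b' (fun w => by simp)
        (by simpa [sub_eq_zero] using hbb.symm))
    (uniformProb_nonneg _)
  have hany : uniformProb (fun w : V × V => ∃ b ∈ insert 0 T, A (w.1 + b • w.2) ≠ v) ≤
      16 / 1000 := by
    refine (uniformProb_mono (E' := fun w : V × V => (∃ b ∈ T, A (w.1 + b • w.2) ≠ A w.1) ∨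
      A (w.1 + (0 : F) • w.2) ≠ v) ?_).trans ((uniformProb_or_le _ _).trans ?_)
    · rintro w ⟨b, hb, hbw⟩
      by_contra! h
      rcases Finset.mem_insert.1 hb with rfl | hb
      · exact hbw h.2
      · refine hbw ((h.1 b hb).trans ?_)
        simpa using h.2
    · rw [hdir 0]
      linarith
  rw [Finset.card_insert_of_notMem hT0, hT] at hsecond
  have hτ0 : 0 ≤ τ := uniformProb_nonneg _
  push_cast at hsecond
  nlinarith

/-- A function `f` admitting accurate predictions on random lines is close to a function whose
restriction to every line is a polynomial of degree at most `d`. -/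
theorem exists_close_degree_le_on_lines [Fintype F] (R : RandomLinePolys ι f d δ) (hδ : 0 ≤ δ)
    (hsmall : (d + 1) ^ 2 * δ ≤ 1 / 1000) (hq : d + 2 ≤ Fintype.card F) :
    ∃ g : V → F, relDist f g ≤ 2 * (d + 2) * δ ∧
      ∀ x h, ∃ C : F[X], C.natDegree ≤ d ∧ ∀ s : F, g (x + s • h) = C.eval s := by
  classical
  obtain ⟨T, hTsub, hT⟩ := Finset.exists_subset_card_eq
    (s := (Finset.univ : Finset F).erase 0) (n := d + 1)
    (by rw [Finset.card_erase_of_mem (Finset.mem_univ _), Finset.card_univ]; omega)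
  have hT0 : (0 : F) ∉ T := fun h => (Finset.mem_erase.1 (hTsub h)).1 rfl
  have hne : ∀ i ∈ T, i ≠ 0 := fun i hi h => hT0 (h ▸ hi)
  choose g hg using fun y => R.exists_uniformProb_extrapolate_ne_le hδ hsmall hT hT0 y
  refine ⟨g, ?_, ?_⟩
  · -- Where `f x ≠ g x`, most extrapolations to `x` differ from `f x`.
    have h1 : uniformProb (fun w : V × V => f w.1 ≠ extrapolate f T w.1 w.2) ≤ (d + 2) * δ := by
      rw [← uniformProb_snd (α := ι)]
      refine (uniformProb_mono (E' := fun w : ι × V × V => ∃ s ∈ insert 0 T,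
        (R.poly w.1 w.2.1 w.2.2).eval s ≠ f (w.2.1 + s • w.2.2)) ?_).trans
        ((uniformProb_exists_mem_le_card_mul _ _ fun s _ => R.error_le s).trans (le_of_eq ?_))
      · intro w hw
        by_contra! h
        have h0 := h 0 (Finset.mem_insert_self _ _)
        rw [R.eval_zero_eq_extrapolate hT fun t ht => h t (Finset.mem_insert_of_mem ht),
          zero_smul, add_zero] at h0
        exact hw h0.symm
      · rw [Finset.card_insert_of_notMem hT0, hT]
        push_cast; ring
    have h2 : relDist f g * (1 / 2) ≤
        uniformProb (fun w : V × V => f w.1 ≠ extrapolate f T w.1 w.2) := by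
      rw [relDist, uniformProb_prod, uniformProb_eq_expect, Finset.expect_mul]
      refine Finset.expect_le_expect fun x _ => ?_
      split_ifs with hx
      · have h3 := uniformProb_mono (E := fun h => ¬ extrapolate f T x h ≠ g x)
          (E' := fun h => f x ≠ extrapolate f T x h) fun h hh he => hx (by
            rw [he]; exact not_not.1 hh)
        rw [uniformProb_not] at h3
        have h4 := hg x
        have h5 := uniformProb_nonneg fun h => extrapolate f T x h ≠ g x
        have : (0 : ℝ) ≤ d := by positivity
        nlinarith
      · rw [zero_mul]
        exact uniformProb_nonneg _
    linarith
  intro x h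
  -- The rows of the ruled surface `x + s h + t (h₁ + s h₂)` at fixed `t` are random lines; they
  -- extrapolate to a polynomial on the line `t = 0`.
  set C : ι × V × V → F[X] := fun w => ∑ t ∈ T,
    Polynomial.C (zeroWeight T t) * R.poly w.1 (x + t • w.2.1) (h + t • w.2.2) with hC
  have hCdeg : ∀ w, (C w).natDegree ≤ d := fun w =>
    natDegree_sum_le_of_forall_le _ _ fun t _ =>
      (natDegree_C_mul_le _ _).trans (R.natDegree_le _ _ _)
  have hCerr : ∀ s : F, uniformProb (fun w : ι × V × V => (C w).eval s ≠ g (x + s • h)) ≤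
      (d + 1) * δ + uniformProb (fun k => extrapolate f T (x + s • h) k ≠ g (x + s • h)) := by
    intro s
    have hcol : uniformProb (fun w : ι × V × V =>
        extrapolate f T (x + s • h) (w.2.1 + s • w.2.2) ≠ g (x + s • h)) =
        uniformProb (fun k => extrapolate f T (x + s • h) k ≠ g (x + s • h)) := by
      rw [uniformProb_snd (α := ι) fun w : V × V =>
        extrapolate f T (x + s • h) (w.1 + s • w.2) ≠ g (x + s • h)]
      exact uniformProb_affine (fun k => extrapolate f T (x + s • h) k ≠ g (x + s • h))
        (fun w => w.1 + s • w.2) 0 1 s (fun w => by simp) (by simp)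
    rw [← hcol]
    refine (uniformProb_mono (E' := fun w : ι × V × V => (∃ t ∈ T,
      (R.poly w.1 (x + t • w.2.1) (h + t • w.2.2)).eval s ≠
        f (x + t • w.2.1 + s • (h + t • w.2.2))) ∨
      extrapolate f T (x + s • h) (w.2.1 + s • w.2.2) ≠ g (x + s • h)) ?_).trans
      ((uniformProb_or_le _ _).trans (add_le_add_left ?_ _))
    · intro w hw
      by_contra! hgood
      refine hw ?_
      rw [← hgood.2, hC, extrapolate, eval_finsetSum]
      refine Finset.sum_congr rfl fun t ht => ?_
      rw [eval_mul, eval_C, hgood.1 t ht]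
      congr 2
      module
    · refine (uniformProb_exists_mem_le_card_mul T _ fun t ht => R.error_affine_le s
        (fun w => (x + t • w.1, h + t • w.2)) x h t 0 0 t (fun w => by simp)
        (by simpa using hne t ht)).trans (le_of_eq ?_)
      rw [hT]; push_cast; ring
  -- The union bound is affordable over `d + 2` columns `s`, whatever the size of the field.
  have hlocal : ∀ W : Finset F, W.card ≤ d + 2 →
      ∃ Q : F[X], Q.natDegree ≤ d ∧ ∀ s ∈ W, Q.eval s = g (x + s • h) := by
    intro W hW
    have hlt : uniformProb (fun w : ι × V × V => ∃ s ∈ W, (C w).eval s ≠ g (x + s • h)) < 1 := by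
      refine lt_of_le_of_lt (uniformProb_exists_mem_le_card_mul W _
        (r := (d + 1) * δ + 1 / (50 * (d + 2))) fun s _ => (hCerr s).trans ?_) ?_
      · gcongr
        rw [le_div_iff₀ (by positivity)]
        have := hg (x + s • h)
        linarith
      · have hW' : (W.card : ℝ) ≤ d + 2 := by exact_mod_cast hW
        have hd : (0 : ℝ) ≤ d := by positivity
        calc (W.card : ℝ) * ((d + 1) * δ + 1 / (50 * (d + 2)))
            ≤ (d + 2) * ((d + 1) * δ + 1 / (50 * (d + 2))) := by gcongr
          _ = (d + 2) * (d + 1) * δ + 1 / 50 := by field_simp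
          _ ≤ 2 * ((d + 1) ^ 2 * δ) + 1 / 50 := by
            nlinarith [mul_nonneg hd hδ, mul_nonneg hd (mul_nonneg hd hδ)]
          _ < 1 := by linarith
    have : Nonempty (ι × V × V) := inferInstance
    obtain ⟨w, hw⟩ := exists_not_of_uniformProb_lt_one hlt
    push Not at hw
    exact ⟨C w, hCdeg w, hw⟩
  obtain ⟨Q, hQ, hQT⟩ := hlocal T (by omega)
  refine ⟨Q, hQ, fun s => ?_⟩
  obtain ⟨Q', hQ', hQT'⟩ := hlocal (insert s T) ((Finset.card_insert_le _ _).trans (by omega))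
  have hlt : ∀ P : F[X], P.natDegree ≤ d → P.degree < T.card := fun P hP =>
    lt_of_le_of_lt P.degree_le_natDegree (by exact_mod_cast (by omega : P.natDegree < T.card))
  have hQQ : Q = Q' := Polynomial.eq_of_degrees_lt_of_eval_finset_eq T (hlt Q hQ) (hlt Q' hQ')
    fun t ht => by rw [hQT t ht, hQT' t (Finset.mem_insert_of_mem ht)]
  rw [hQQ, hQT' s (Finset.mem_insert_self _ _)]

end RandomLinePolys

end Correction

/-! ### Polynomials of low degree on every line -/

section Lucas

theorem not_dvd_choose_iff {p : ℕ} (hp : p.Prime) (a b : ℕ) :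
    ¬ p ∣ a.choose b ↔ ¬ p ∣ (a % p).choose (b % p) ∧ ¬ p ∣ (a / p).choose (b / p) := by
  have := Fact.mk hp
  rw [(Choose.choose_modEq_choose_mod_mul_choose_div_nat (p := p) (n := a) (k := b)).dvd_iff
    dvd_rfl, hp.dvd_mul, not_or]

theorem not_dvd_choose_of_lt {p : ℕ} (hp : p.Prime) {a b : ℕ} (ha : a < p) (hb : b ≤ a) :
    ¬ p ∣ a.choose b := by
  intro h
  have h1 : p ∣ a.factorial := h.trans ⟨b.factorial * (a - b).factorial, by
    rw [← mul_assoc, Nat.choose_mul_factorial_mul_factorial hb]⟩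
  exact absurd ((hp.dvd_factorial).1 h1) (by omega)

theorem le_of_not_dvd_choose {p a b : ℕ} (h : ¬ p ∣ a.choose b) : b ≤ a := by
  by_contra hlt
  exact h (by simp [Nat.choose_eq_zero_of_lt (not_le.1 hlt)])

/-- Below `p ^ (n + 1)`, consecutive numbers dominated digit by digit by `a` in base `p` differ by
at most `p ^ n`. -/
theorem exists_lt_le_not_dvd_choose {p : ℕ} (hp : p.Prime) (n : ℕ) :
    ∀ a b : ℕ, b < a → a < p ^ (n + 1) → ¬ p ∣ a.choose b →
      ∃ b', b < b' ∧ b' ≤ b + p ^ n ∧ ¬ p ∣ a.choose b' := by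
  induction n with
  | zero =>
    intro a b hba ha _
    rw [zero_add, pow_one] at ha
    exact ⟨b + 1, by omega, by simp, not_dvd_choose_of_lt hp ha hba⟩
  | succ n ih =>
    intro a b hba ha hab
    have hab' := (not_dvd_choose_iff hp a b).1 hab
    have hp0 := hp.pos
    have hle := le_of_not_dvd_choose hab'.1
    have hdiva := Nat.div_add_mod a p
    have hdivb := Nat.div_add_mod b p
    have hamod := Nat.mod_lt a hp0
    rcases hle.lt_or_eq with hlt | heq
    · refine ⟨b + 1, by omega, by have := Nat.one_le_pow (n + 1) p hp0; omega, ?_⟩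
      have hsplit : b + 1 = (b % p + 1) + p * (b / p) := by omega
      have hmod : (b + 1) % p = b % p + 1 := by
        rw [hsplit, Nat.add_mul_mod_self_left, Nat.mod_eq_of_lt (a := b % p + 1) (by omega)]
      have hdiv : (b + 1) / p = b / p := by
        rw [hsplit, Nat.add_mul_div_left _ _ hp0, Nat.div_eq_of_lt (a := b % p + 1) (by omega),
          zero_add]
      rw [not_dvd_choose_iff hp, hmod, hdiv]
      exact ⟨not_dvd_choose_of_lt hp hamod hlt, hab'.2⟩
    · have hlt : b / p < a / p := by
        by_contra hge
        have := Nat.mul_le_mul_left p (not_lt.1 hge)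
        omega
      have hap : a / p < p ^ (n + 1) := Nat.div_lt_of_lt_mul (by rwa [← pow_succ'])
      obtain ⟨c, hc1, hc2, hc3⟩ := ih _ _ hlt hap hab'.2
      refine ⟨b % p + p * c, ?_, ?_, ?_⟩
      · have := Nat.mul_lt_mul_of_pos_left hc1 hp0
        omega
      · have := Nat.mul_le_mul_left p hc2
        rw [mul_add, ← pow_succ'] at this
        omega
      · rw [not_dvd_choose_iff hp, Nat.add_mul_mod_self_left, Nat.add_mul_div_left _ _ hp0,
          Nat.mod_mod, Nat.div_eq_of_lt (Nat.mod_lt _ hp0), zero_add]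
        exact ⟨hab'.1, hc3⟩

/-- Every exponent vector `I` of degree more than `d` dominates, digit by digit in base `p`, an
exponent vector whose degree lies in the window `(d, d + p ^ n]`. -/
theorem exists_dominated_sum_mem_window {p : ℕ} (hp : p.Prime) (n d : ℕ) {σ : Type*} [Fintype σ]
    (I : σ → ℕ) (hI : ∀ l, I l < p ^ (n + 1)) (hd : d < ∑ l, I l) :
    ∃ J : σ → ℕ, (∀ l, ¬ p ∣ (I l).choose (J l)) ∧ d < ∑ l, J l ∧ ∑ l, J l ≤ d + p ^ n := by
  classical
  set P : ℕ → Prop := fun s => ∃ J : σ → ℕ, (∀ l, ¬ p ∣ (I l).choose (J l)) ∧ ∑ l, J l = s with hP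
  have hP0 : P 0 := ⟨fun _ => 0, fun l => by simpa using hp.one_lt.ne', by simp⟩
  obtain ⟨J, hJ, hJs⟩ := Nat.findGreatest_spec (P := P) (Nat.zero_le d) hP0
  have hJd : Nat.findGreatest P d ≤ d := Nat.findGreatest_le d
  obtain ⟨l, hl⟩ : ∃ l, J l < I l := by
    by_contra! h
    have := Finset.sum_le_sum fun l (_ : l ∈ Finset.univ) => h l
    omega
  obtain ⟨b, hb1, hb2, hb3⟩ := exists_lt_le_not_dvd_choose hp n _ _ hl (hI l) (hJ l)
  have hdom : ∀ k, ¬ p ∣ (I k).choose (Function.update J l b k) := by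
    intro k
    by_cases hk : k = l
    · subst hk; simpa using hb3
    · simpa [hk] using hJ k
  have hsum : ∑ k, Function.update J l b k + J l = ∑ k, J k + b := by
    rw [Finset.sum_update_of_mem (Finset.mem_univ l),
      ← Finset.add_sum_erase _ J (Finset.mem_univ l), Finset.sdiff_singleton_eq_erase]
    ring
  refine ⟨Function.update J l b, hdom, ?_, by omega⟩
  by_contra hle
  exact Nat.findGreatest_is_greatest (P := P) (n := d) (k := ∑ k, Function.update J l b k)
    (by omega) (by omega) ⟨_, hdom, rfl⟩

end Lucas

section Lines

variable {F : Type*} [Field F] [Fintype F]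

theorem sum_eval_mul_pow_eq_zero {C : F[X]} {k : ℕ} (h : C.natDegree + k < Fintype.card F - 1) :
    ∑ t : F, C.eval t * t ^ k = 0 := by
  simp_rw [Polynomial.eval_eq_sum_range, Finset.sum_mul]
  rw [Finset.sum_comm]
  refine Finset.sum_eq_zero fun i hi => ?_
  have := Finset.mem_range.1 hi
  simp_rw [mul_assoc, ← pow_add, ← Finset.mul_sum]
  rw [FiniteField.sum_pow_lt_card_sub_one F _ (by omega), mul_zero]

theorem sum_pow_card_sub_one_ne_zero : ∑ t : F, t ^ (Fintype.card F - 1) ≠ 0 := by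
  classical
  have h1 := Fintype.one_lt_card (α := F)
  have h : ∀ t : F, t ^ (Fintype.card F - 1) = 1 - if t = 0 then 1 else 0 := by
    intro t
    split_ifs with ht
    · rw [ht, zero_pow (by omega), sub_self]
    · rw [FiniteField.pow_card_sub_one_eq_one t ht, sub_zero]
  simp [h, Finset.sum_sub_distrib]

variable {σ : Type*} [Fintype σ]

/-- The exponent vector of the monomial `x ^ (I - J) h ^ J` in the variables `(x, h)`. -/
noncomputable def lineExponent (I J : σ → ℕ) : σ ⊕ σ →₀ ℕ :=
  Finsupp.equivFunOnFinite.symm (Sum.elim (fun l => I l - J l) J)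

/-- The polynomial in `(x, h)` computing `∑ t, G (x + t h) t ^ k`. -/
noncomputable def lineMoment (G : MvPolynomial σ F) (k : ℕ) : MvPolynomial (σ ⊕ σ) F :=
  open Classical in
  ∑ I ∈ G.support, ∑ J ∈ Fintype.piFinset fun l => Finset.range (I l + 1),
    MvPolynomial.monomial (lineExponent I J)
      (G.coeff I * (∏ l, ((I l).choose (J l) : F)) * ∑ t : F, t ^ (∑ l, J l + k))

theorem eval_lineMoment (G : MvPolynomial σ F) (k : ℕ) (x h : σ → F) :
    MvPolynomial.eval (Sum.elim x h) (lineMoment G k) =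
      ∑ t : F, MvPolynomial.eval (x + t • h) G * t ^ k := by
  classical
  simp_rw [fun t : F => MvPolynomial.eval_eq' (x + t • h) G, Finset.sum_mul]
  rw [lineMoment, map_sum, Finset.sum_comm]
  refine Finset.sum_congr rfl fun I _ => ?_
  have hexp : ∀ t : F, ∏ l, (x + t • h) l ^ I l =
      ∑ J ∈ Fintype.piFinset fun l => Finset.range (I l + 1),
        (∏ l, ((I l).choose (J l) : F)) * (∏ l, x l ^ (I l - J l)) * (∏ l, h l ^ J l) *
          t ^ ∑ l, J l := by
    intro t
    have hl : ∀ l, (x + t • h) l ^ I l = ∑ j ∈ Finset.range (I l + 1),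
        (t * h l) ^ j * x l ^ (I l - j) * ((I l).choose j : F) := by
      intro l
      rw [← add_pow, Pi.add_apply, Pi.smul_apply, smul_eq_mul, add_comm]
    simp_rw [hl]
    rw [Finset.prod_univ_sum]
    refine Finset.sum_congr rfl fun J _ => ?_
    rw [← Finset.prod_pow_eq_pow_sum, ← Finset.prod_mul_distrib, ← Finset.prod_mul_distrib,
      ← Finset.prod_mul_distrib]
    exact Finset.prod_congr rfl fun l _ => by rw [mul_pow]; ring
  simp_rw [hexp, Finset.mul_sum, Finset.sum_mul]
  rw [map_sum, Finset.sum_comm]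
  refine Finset.sum_congr rfl fun J _ => ?_
  rw [MvPolynomial.eval_monomial, Finsupp.prod_fintype _ _ (fun _ => pow_zero _),
    Fintype.prod_sum_type, Finset.sum_mul]
  refine Finset.sum_congr rfl fun t _ => ?_
  simp only [lineExponent, Finsupp.equivFunOnFinite_symm_apply_apply, Sum.elim_inl, Sum.elim_inr]
  rw [pow_add]
  ring

theorem coeff_lineMoment (G : MvPolynomial σ F) (k : ℕ) (I : σ →₀ ℕ) (J : σ → ℕ)
    (hJ : ∀ l, J l ≤ I l) :
    (lineMoment G k).coeff (lineExponent I J) =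
      G.coeff I * (∏ l, ((I l).choose (J l) : F)) * ∑ t : F, t ^ (∑ l, J l + k) := by
  classical
  simp only [lineMoment, MvPolynomial.coeff_sum, MvPolynomial.coeff_monomial]
  have hinj : ∀ I' : σ →₀ ℕ, ∀ J' ∈ Fintype.piFinset (fun l => Finset.range (I' l + 1)),
      lineExponent I' J' = lineExponent I J → I' = I ∧ J' = J := by
    intro I' J' hJ' h
    have h1 := Finsupp.equivFunOnFinite.symm.injective h
    have hJJ : J' = J := funext fun l => by simpa using congrFun h1 (Sum.inr l)
    refine ⟨Finsupp.ext fun l => ?_, hJJ⟩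
    have h2 : I' l - J' l = I l - J l := by simpa using congrFun h1 (Sum.inl l)
    have h3 := Finset.mem_range.1 (Fintype.mem_piFinset.1 hJ' l)
    have h4 := hJ l
    rw [← hJJ] at h2 h4
    omega
  rw [Finset.sum_eq_single I, Finset.sum_eq_single J]
  · simp
  · intro J' hJ' hne
    exact if_neg fun h => hne (hinj I J' hJ' h).2
  · intro h
    exact absurd (Fintype.mem_piFinset.2 fun l => Finset.mem_range.2 (Nat.lt_succ_of_le (hJ l))) h
  · intro I' _ hne
    exact Finset.sum_eq_zero fun J' hJ' => if_neg fun h => hne (hinj I' J' hJ' h).1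
  · intro h
    rw [MvPolynomial.notMem_support_iff] at h
    exact Finset.sum_eq_zero fun J' _ => by simp [h]

/-- A function on `F ^ σ` whose restriction to every line is a polynomial of degree at most `d` is
a polynomial of total degree at most `d`, provided that `q - q / p - 1 ≥ d`. -/
theorem exists_totalDegree_le_of_degree_le_on_lines {p n d : ℕ} (hp : p.Prime) [CharP F p]
    (hcard : Fintype.card F = p ^ (n + 1)) (hd : d + p ^ n + 1 ≤ Fintype.card F)
    (g : (σ → F) → F)
    (hg : ∀ x h, ∃ C : F[X], C.natDegree ≤ d ∧ ∀ s : F, g (x + s • h) = C.eval s) :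
    ∃ G : MvPolynomial σ F, G.totalDegree ≤ d ∧ ∀ x, MvPolynomial.eval x G = g x := by
  classical
  have hmem : g ∈ (MvPolynomial.restrictDegree σ F (Fintype.card F - 1)).map
      (MvPolynomial.evalₗ F σ) := by
    rw [MvPolynomial.map_restrict_dom_evalₗ]; trivial
  obtain ⟨G, hG, hGg⟩ := hmem
  have heval : ∀ x, MvPolynomial.eval x G = g x := fun x => congrFun hGg x
  rw [SetLike.mem_coe, MvPolynomial.mem_restrictDegree] at hG
  refine ⟨G, ?_, heval⟩
  have h1 := Fintype.one_lt_card (α := F)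
  refine Finset.sup_le fun I hI => ?_
  by_contra! hlt
  rw [Finsupp.sum_fintype _ _ fun _ => rfl] at hlt
  obtain ⟨J, hJ, hJd, hJn⟩ := exists_dominated_sum_mem_window hp n d I
    (fun l => by have := hG I hI l; omega) hlt
  set e := ∑ l, J l with he
  -- Extract the coefficient of `t ^ e` on every line.
  have hrestrict : lineMoment G (Fintype.card F - 1 - e) ∈
      MvPolynomial.restrictDegree (σ ⊕ σ) F (Fintype.card F - 1) := by
    refine Submodule.sum_mem _ fun I' hI' => Submodule.sum_mem _ fun J' hJ' => ?_
    rw [MvPolynomial.mem_restrictDegree]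
    intro s hs l
    rw [Finset.mem_singleton.1 (MvPolynomial.support_monomial_subset hs)]
    rcases l with l | l
    · exact (Nat.sub_le _ _).trans (hG I' hI' l)
    · exact (Nat.lt_succ_iff.1 (Finset.mem_range.1 (Fintype.mem_piFinset.1 hJ' l))).trans
        (hG I' hI' l)
  have hzero : lineMoment G (Fintype.card F - 1 - e) = 0 := by
    refine MvPolynomial.eq_zero_of_eval_zero_at_prod_finset _ (fun _ => Finset.univ)
      (fun l => ?_) (fun w _ => ?_)
    · rw [MvPolynomial.degreeOf_lt_iff (Finset.card_pos.2 Finset.univ_nonempty), Finset.card_univ]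
      intro s hs
      have := (MvPolynomial.mem_restrictDegree _ _ _).1 hrestrict s hs l
      omega
    · rw [← Sum.elim_comp_inl_inr w, eval_lineMoment]
      obtain ⟨C, hC, hCg⟩ := hg (w ∘ Sum.inl) (w ∘ Sum.inr)
      simp_rw [heval, hCg]
      exact sum_eval_mul_pow_eq_zero (by omega)
  have hcoeff := coeff_lineMoment G (Fintype.card F - 1 - e) I J
    fun l => le_of_not_dvd_choose (hJ l)
  rw [hzero, MvPolynomial.coeff_zero, ← he, Nat.add_sub_cancel' (by omega)] at hcoeff
  refine mul_ne_zero (mul_ne_zero (MvPolynomial.mem_support_iff.1 hI) ?_)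
    sum_pow_card_sub_one_ne_zero hcoeff.symm
  exact Finset.prod_ne_zero_iff.2 fun l _ => by
    rw [Ne, CharP.cast_eq_zero_iff F p]
    exact hJ l

end Lines

/-! ### Distance and soundness -/

section Distance

variable {F V : Type*} [Field F] [Fintype F] [AddCommGroup V] [Module F V] [Fintype V]

open Classical in
/-- On one line, let `C` be a polynomial of degree at most `d` and suppose `φ` differs from it at
`e` points. Then every polynomial `P` of degree at most `d` differs from `φ` at at least
`e - e (e - 1) / (q - d - 1)` points. -/
theorem card_sub_le_card_filter_eval_ne {d : ℕ} (hq : d + 2 ≤ Fintype.card F) (φ : F → F)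
    {C P : F[X]} (hC : C.natDegree ≤ d) (hP : P.natDegree ≤ d) :
    let e : ℝ := ((Finset.univ.filter fun t => φ t ≠ C.eval t).card : ℝ)
    e - (e ^ 2 - e) / ((Fintype.card F : ℝ) - d - 1) ≤
      ((Finset.univ.filter fun t => P.eval t ≠ φ t).card : ℝ) := by
  intro e
  have hn : (1 : ℝ) ≤ (Fintype.card F : ℝ) - d - 1 := by
    have : ((d + 2 : ℕ) : ℝ) ≤ Fintype.card F := by exact_mod_cast hq
    push_cast at this
    linarith
  have hint : 0 ≤ e ^ 2 - e := by
    have : (e : ℝ) ^ 2 - e = ((((Finset.univ.filter fun t => φ t ≠ C.eval t).card : ℤ) *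
      ((Finset.univ.filter fun t => φ t ≠ C.eval t).card - 1) : ℤ) : ℝ) := by
      push_cast; ring
    rw [this]
    have : (0 : ℤ) ≤ ((Finset.univ.filter fun t => φ t ≠ C.eval t).card : ℤ) *
      ((Finset.univ.filter fun t => φ t ≠ C.eval t).card - 1) := by
      rcases Nat.eq_zero_or_pos (Finset.univ.filter fun t => φ t ≠ C.eval t).card with h | h
      · simp [h]
      · exact mul_nonneg (by positivity) (by omega)
    exact_mod_cast this
  by_cases hPC : P = C
  · subst hPC
    have : (Finset.univ.filter fun t => P.eval t ≠ φ t) =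
        Finset.univ.filter fun t => φ t ≠ P.eval t := by
      simp only [ne_comm]
    rw [this]
    have : 0 ≤ (e ^ 2 - e) / ((Fintype.card F : ℝ) - d - 1) := div_nonneg hint (by linarith)
    linarith
  · -- `P` and `C` agree at no more than `d` points, so one of them differs from `φ` elsewhere.
    have hagree : (Finset.univ.filter fun t => P.eval t = C.eval t).card ≤ d := by
      by_contra! hlt
      refine hPC (Polynomial.eq_of_degrees_lt_of_eval_finset_eq
        (Finset.univ.filter fun t => P.eval t = C.eval t) ?_ ?_ fun t ht => by simpa using ht)
      · exact lt_of_le_of_lt P.degree_le_natDegree (by exact_mod_cast hP.trans_lt hlt)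
      · exact lt_of_le_of_lt C.degree_le_natDegree (by exact_mod_cast hC.trans_lt hlt)
    have hcover : Fintype.card F ≤ (Finset.univ.filter fun t => P.eval t = C.eval t).card +
        ((Finset.univ.filter fun t => φ t ≠ C.eval t).card +
          (Finset.univ.filter fun t => P.eval t ≠ φ t).card) := by
      refine le_trans ?_ ((Finset.card_union_le _ _).trans
        (Nat.add_le_add_left (Finset.card_union_le _ _) _))
      rw [← Finset.card_univ]
      refine Finset.card_le_card fun t _ => ?_
      simp only [Finset.mem_union, Finset.mem_filter_univ]
      by_cases h1 : φ t = C.eval t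
      · by_cases h2 : P.eval t = φ t
        · exact Or.inl (h2.trans h1)
        · exact Or.inr (Or.inr h2)
      · exact Or.inr (Or.inl h1)
    have hr : (Fintype.card F : ℝ) - d - e ≤
        ((Finset.univ.filter fun t => P.eval t ≠ φ t).card : ℝ) := by
      have : (Fintype.card F : ℝ) ≤ d + (e +
          ((Finset.univ.filter fun t => P.eval t ≠ φ t).card : ℝ)) := by
        have h := hcover.trans (Nat.add_le_add_right hagree _)
        have h' := (Nat.cast_le (α := ℝ)).2 h
        push_cast at h'
        exact h'
      linarith
    refine le_trans ?_ hr
    -- With `n = q - d - 1` the claim is `(n - e) (n - e + 1) ≥ 0`, true for integers.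
    set n : ℝ := (Fintype.card F : ℝ) - d - 1 with hndef
    have hprod : 0 ≤ (n - e) * (n - e + 1) := by
      set z : ℤ := (Fintype.card F : ℤ) - d - 1 -
        ((Finset.univ.filter fun t => φ t ≠ C.eval t).card : ℤ) with hz
      have hz' : n - e = (z : ℝ) := by rw [hz]; push_cast; rfl
      have : 0 ≤ z * (z + 1) := by
        rcases lt_or_ge z 0 with h | h
        · exact mul_nonneg_of_nonpos_of_nonpos h.le (by omega)
        · positivity
      rw [hz']
      exact_mod_cast this
    have hdiv : e - (n + 1 - e) ≤ (e ^ 2 - e) / n := by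
      rw [le_div_iff₀ (by linarith)]
      nlinarith
    have : (Fintype.card F : ℝ) - d - e = n + 1 - e := by rw [hndef]; ring
    linarith

/-- If `g` has degree at most `d` on every line, then its distance `ε` from `f` and the error of any
lines test for `f` satisfy `ε - (d + 1) ε² ≤ error`. -/
theorem relDist_sub_le_uniformProb {d : ℕ} (hq : d + 2 ≤ Fintype.card F) (f g : V → F)
    (hg : ∀ x h, ∃ C : F[X], C.natDegree ≤ d ∧ ∀ s : F, g (x + s • h) = C.eval s)
    (P : V → V → F[X]) (hP : ∀ x h, (P x h).natDegree ≤ d) :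
    relDist f g - (d + 1) * relDist f g ^ 2 ≤ uniformProb fun w : V × V × F =>
      (P w.1 w.2.1).eval w.2.2 ≠ f (w.1 + w.2.2 • w.2.1) := by
  classical
  set ε := relDist f g with hε
  set q : ℝ := (Fintype.card F : ℝ) with hqdef
  set n : ℝ := q - d - 1 with hn
  have hn1 : 1 ≤ n := by
    have : ((d + 2 : ℕ) : ℝ) ≤ q := Nat.cast_le.2 hq
    push_cast at this
    linarith
  have hq0 : 0 < q := Nat.cast_pos.2 Fintype.card_pos
  set e : V × V → ℝ := fun w =>
    ((Finset.univ.filter fun t : F => f (w.1 + t • w.2) ≠ g (w.1 + t • w.2)).card : ℝ) with he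
  set r : V × V → ℝ := fun w =>
    ((Finset.univ.filter fun t : F => (P w.1 w.2).eval t ≠ f (w.1 + t • w.2)).card : ℝ) with hr
  have hline : ∀ w, e w - (e w ^ 2 - e w) / n ≤ r w := by
    intro w
    obtain ⟨C, hC, hCg⟩ := hg w.1 w.2
    have := card_sub_le_card_filter_eval_ne hq (fun t => f (w.1 + t • w.2)) hC (hP w.1 w.2)
    simp only [← hCg] at this
    exact this
  have hpoint : ∀ t : F, uniformProb (fun w : V × V => f (w.1 + t • w.2) ≠ g (w.1 + t • w.2)) = ε :=
    fun t => uniformProb_affine (fun x => f x ≠ g x) (fun w => w.1 + t • w.2) 0 1 t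
      (fun w => by simp) (by simp)
  have hpair : ∀ t s : F, t ≠ s → uniformProb (fun w : V × V =>
      f (w.1 + t • w.2) ≠ g (w.1 + t • w.2) ∧ f (w.1 + s • w.2) ≠ g (w.1 + s • w.2)) = ε * ε := by
    intro t s hts
    rw [hε, relDist, ← uniformProb_fst_and_snd]
    exact uniformProb_affine_pair (fun w : V × V => f w.1 ≠ g w.1 ∧ f w.2 ≠ g w.2)
      (fun w => (w.1 + t • w.2, w.1 + s • w.2)) 0 0 1 t 1 s (fun w => by simp)
      (by simpa [sub_eq_zero] using hts.symm)
  have hEe : Finset.univ.expect e = q * ε := by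
    simp only [he, ← Finset.sum_boole]
    rw [Finset.expect_sum_comm, Finset.sum_congr rfl fun t _ =>
      (uniformProb_eq_expect _).symm.trans (hpoint t)]
    simp [hqdef]
  have hEe2 : Finset.univ.expect (fun w => e w ^ 2) = q * ε + q * (q - 1) * ε ^ 2 := by
    have hsq : ∀ w, e w ^ 2 = ∑ t : F, ∑ s : F, if f (w.1 + t • w.2) ≠ g (w.1 + t • w.2) ∧
        f (w.1 + s • w.2) ≠ g (w.1 + s • w.2) then (1 : ℝ) else 0 := by
      intro w
      simp only [he, ← Finset.sum_boole]
      rw [sq, Finset.sum_mul_sum]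
      refine Finset.sum_congr rfl fun t _ => Finset.sum_congr rfl fun s _ => ?_
      by_cases h1 : f (w.1 + t • w.2) = g (w.1 + t • w.2) <;>
        by_cases h2 : f (w.1 + s • w.2) = g (w.1 + s • w.2) <;> simp [h1, h2]
    simp_rw [hsq]
    rw [Finset.expect_sum_comm]
    calc _ = ∑ t : F, ∑ s : F, ((if t = s then ε - ε ^ 2 else 0) + ε ^ 2) := by
          refine Finset.sum_congr rfl fun t _ => ?_
          rw [Finset.expect_sum_comm]
          refine Finset.sum_congr rfl fun s _ => ?_
          rw [← uniformProb_eq_expect]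
          split_ifs with h
          · subst h
            simp only [and_self, hpoint]
            ring
          · rw [hpair t s h]; ring
      _ = q * ε + q * (q - 1) * ε ^ 2 := by
          simp only [Finset.sum_add_distrib, Finset.sum_ite_eq, Finset.mem_univ, if_true,
            Finset.sum_const, Finset.card_univ, nsmul_eq_mul]
          rw [← hqdef]
          ring
  have hEr : Finset.univ.expect r = q * uniformProb fun w : V × V × F =>
      (P w.1 w.2.1).eval w.2.2 ≠ f (w.1 + w.2.2 • w.2.1) := by
    rw [← uniformProb_comp_equiv (Equiv.prodAssoc V V F), uniformProb_prod, Finset.mul_expect]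
    refine Finset.expect_congr rfl fun w _ => ?_
    rw [uniformProb, ← hqdef, mul_div_cancel₀ _ hq0.ne']
    simp only [Equiv.prodAssoc_apply]
  have hmain : q * ε - (q * (q - 1) * ε ^ 2) / n ≤ Finset.univ.expect r := by
    calc q * ε - (q * (q - 1) * ε ^ 2) / n
        = Finset.univ.expect fun w => (e w - (e w ^ 2 - e w) / n) := by
          rw [Finset.expect_sub_distrib, ← Finset.expect_div, Finset.expect_sub_distrib, hEe, hEe2]
          ring
      _ ≤ _ := Finset.expect_le_expect fun w _ => hline w
  rw [hEr] at hmain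
  have hratio : (q - 1) / n ≤ d + 1 := by
    rw [div_le_iff₀ (by linarith)]
    have : (0 : ℝ) ≤ d := by positivity
    nlinarith
  refine le_of_mul_le_mul_left (le_trans ?_ hmain) hq0
  have : q * (q - 1) * ε ^ 2 / n = q * (ε ^ 2 * ((q - 1) / n)) := by ring
  rw [this, ← mul_sub]
  gcongr q * (ε - ?_)
  nlinarith [sq_nonneg ε]

end Distance

section Soundness

variable {F : Type*} [Field F] [Fintype F]

/-- Reading each line from a random starting point spreads the error of the lines test evenly over
all positions. -/
noncomputable def RandomLinePolys.ofLinesTest {m d : ℕ} (f : (Fin m → F) → F)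
    (P : (Fin m → F) → (Fin m → F) → F[X]) (hP : ∀ x h, (P x h).natDegree ≤ d) :
    RandomLinePolys F f d (linesTestError f P) where
  poly a x h := (P (x - a • h) h).comp (X + C a)
  natDegree_le a x h := by
    refine natDegree_comp_le.trans ?_
    rw [natDegree_X_add_C, mul_one]
    exact hP _ _
  error_le s := by
    refine le_of_eq ?_
    have hbij : Function.Bijective fun w : F × (Fin m → F) × (Fin m → F) =>
        (w.2.1 - w.1 • w.2.2, w.2.2, s + w.1) := by
      refine Function.bijective_iff_has_inverse.2
        ⟨fun w => (w.2.2 - s, w.1 + (w.2.2 - s) • w.2.1, w.2.1), fun w => ?_, fun w => ?_⟩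
      · simp
      · simp
    rw [linesTestError, ← uniformProb_comp_bijective hbij]
    congr 1
    funext w
    have : w.2.1 - w.1 • w.2.2 + (s + w.1) • w.2.2 = w.2.1 + s • w.2.2 := by module
    simp only [eval_comp, eval_add, eval_X, eval_C, this]

/-- The case `q = p ^ (n + 1)` of soundness, where `q - q / p - 1 ≥ d` reads
`d + p ^ n + 1 ≤ q`. -/
theorem linesTestSound_of_card_eq_pow {p n d : ℕ} (hp : p.Prime) [CharP F p]
    (hcard : Fintype.card F = p ^ (n + 1)) (hd : d + p ^ n + 1 ≤ Fintype.card F) :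
    LinesTestSound 1000 F d := by
  intro m f P δ hP hδ herr
  have hq : d + 2 ≤ Fintype.card F := by
    have := Nat.one_le_pow n p hp.pos
    omega
  set η := linesTestError f P with hη
  have hη0 : 0 ≤ η := uniformProb_nonneg _
  have hd0 : (0 : ℝ) ≤ d := by positivity
  have hsmall : ((d : ℝ) + 1) ^ 2 * η ≤ 1 / 1000 := by
    have h1 := herr.trans hδ
    rw [le_div_iff₀ (by positivity)] at h1
    linarith
  obtain ⟨g, hfg, hg⟩ :=
    (RandomLinePolys.ofLinesTest f P hP).exists_close_degree_le_on_lines hη0 hsmall hq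
  have hdist := relDist_sub_le_uniformProb hq f g hg P hP
  rw [← linesTestError, ← hη] at hdist
  obtain ⟨G, hG, hGg⟩ := exists_totalDegree_le_of_degree_le_on_lines hp hcard hd g hg
  refine ⟨G, hG, ?_⟩
  rw [show (fun x => MvPolynomial.eval x G) = g from funext hGg]
  have hε0 : 0 ≤ relDist f g := uniformProb_nonneg _
  have hhalf : (d + 1) * relDist f g ≤ 1 / 2 := by
    calc (d + 1) * relDist f g ≤ (d + 1) * (2 * (d + 2) * η) := by gcongr
      _ ≤ 4 * ((d + 1) ^ 2 * η) := by
        nlinarith [mul_nonneg hd0 hη0, mul_nonneg hd0 (mul_nonneg hd0 hη0)]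
      _ ≤ 1 / 2 := by linarith
  nlinarith

end Soundness

theorem mainTheorem3 :
    ∃ c : ℝ, 0 < c ∧
      (∀ (F : Type*) [Field F] [Fintype F] (p : ℕ) [CharP F p] (d : ℕ),
        (Fintype.card F : ℝ) - (Fintype.card F : ℝ) / (p : ℝ) - 1 ≥ (d : ℝ) →
        LinesTestSound c F d) ∧
      (∀ (F : Type*) [Field F] [Fintype F] (d : ℕ),
        (Fintype.card F).Prime → Fintype.card F ≥ d + 2 →
        LinesTestSound c F d) := by
  refine ⟨1000, by norm_num, ?_, ?_⟩
  · intro F _ _ p _ d hd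
    obtain ⟨k, hp, hcard⟩ := FiniteField.card F p
    obtain ⟨n, hn⟩ := Nat.exists_eq_add_of_lt k.pos
    rw [hn, zero_add] at hcard
    refine linesTestSound_of_card_eq_pow hp hcard ?_
    have hp0 : (p : ℝ) ≠ 0 := by exact_mod_cast hp.ne_zero
    have hdiv : (Fintype.card F : ℝ) / p = (p : ℝ) ^ n := by
      rw [hcard, Nat.cast_pow, pow_succ, mul_div_cancel_right₀ _ hp0]
    rw [hdiv] at hd
    have : ((d + p ^ n + 1 : ℕ) : ℝ) ≤ Fintype.card F := by push_cast; linarith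
    exact_mod_cast this
  · intro F _ _ d hprime hd
    obtain ⟨p, _⟩ := CharP.exists F
    obtain ⟨k, hp, hcard⟩ := FiniteField.card F p
    have hk : (k : ℕ) = 1 := by
      rw [hcard] at hprime
      exact hprime.eq_one_of_pow
    refine linesTestSound_of_card_eq_pow (n := 0) hp (by rw [hcard, hk]) ?_
    rw [pow_zero]
    omega
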